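/- Let $X$ be a separable real or complex Banach space with closed unit ball $B_X$, and let $L(X)$, the set of bounded operators on $X$, carry the strong operator topology (pointwise norm convergence). Products $L(X)\times L(X)$ carry the product topology, and Borel sets are those generated by these topologies. For a bounded operator $T$ on a Banach space, let $A_n=A_n(T)=\frac1n\sum_{k=0}^{n-1}T^k$ ($n\ge 1$). $T$ is *ergodic* if $(A_n)$ converges in the strong operator topology, and *uniformly ergodic* if $(A_n)$ converges in operator norm. For an ultrafilter $\mathcal U$ on $\mathbb N$, let $X_{\mathcal U}=\ell^\infty(X)/\{(x_n):\lim_{\mathcal U}\|x_n\|=0\}$ with the quotient norm, and let $T_{\mathcal U}$ be the operator on $X_{\mathcal U}$ induced by $(x_n)\mapsto(Tx_n)$. $T\in L(X)$ is *super-ergodic* if $T_{\mathcal U}$ is ergodic for every ultrafilter $\mathcal U$ on $\mathbb N$. Let $\mathcal{SE}(X)$ and $\mathcal{UE}(X)$ be the sets of super-ergodic and of uniformly ergodic operators in $L(X)$. For $T\in L(X)$ and $\varepsilon>0$, let $\mathcal A_e(T,\varepsilon)$ be the tree of all finite strictly increasing sequences $s$ of positive integers such that $|s|\le 1$, or there is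 $x\in B_X$ with $\|A_{s_p}x-A_{s_{p+1}}x\|>\varepsilon$ for all $1\le p<|s|$. The height $h(\mathcal A)$ of a well-founded tree $\mathcal A$ on $\mathbb N$ is $\sup_{s\in\mathcal A}(\rho(s)+1)$, where $\rho(s)=\sup\{\rho(t)+1: t\in\mathcal A \text{ properly extends } s\}$; if $\mathcal A$ is not well founded, put $h(\mathcal A)=\omega_1$. Put $\eta_e(T)=\sup_{\varepsilon>0}h(\mathcal A_e(T,\varepsilon))$. A set is *analytic* if it is empty or a continuous image of $\mathbb N^{\mathbb N}$, and *coanalytic* if its complement is analytic. A *coanalytic rank* on a coanalytic set $C\subseteq P$ is a function $\delta:P\to\mathrm{Ord}$ with $\delta(x)<\omega_1$ for $x\in C$ such that the sets $\{(x,y)\in P^2: x\in C,\ (y\in C\Rightarrow\delta(x)\le\delta(y))\}$ and $\{(x,y)\in P^2: x\in C,\ (y\in C\Rightarrow\delta(x)<\delta(y))\}$ are coanalytic in $P^2$. Then: (a) For every $T\in L(X)$, $T$ is super-ergodic if and only if $\eta_e(T)<\omega_1$; and $\eta_e(T)=\omega_1$ if $T$ is not super-ergodic. (b) $\mathcal{SE}(X)$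 is coanalytic in $L(X)$. (c) $\eta_e$ is a coanalytic rank on $\mathcal{SE}(X)$. (d) There is $\alpha<\omega_1$ such that $\mathcal{UE}(X)\subseteq\{T\in\mathcal{SE}(X):\eta_e(T)\le\alpha\}$. (e) $\mathcal{SE}(X)$ is a Borel subset of $L(X)$ if and only if $\sup_{T\in\mathcal{SE}(X)}\eta_e(T)<\omega_1$. -/

import Mathlib

open Filter Topology Set MeasureTheory
open scoped ENNReal Ordinal

noncomputable section

namespace SuperErgodic

section Operators

variable (𝕜 : Type*) [RCLike 𝕜]

/-- The `n`-th Cesàro mean `(1/n) ∑_{k<n} T^k` of a bounded operator `T` (used for `n ≥ 1`). -/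
def cesaro {𝕜 : Type*} [RCLike 𝕜] {E : Type*} [NormedAddCommGroup E] [NormedSpace 𝕜 E]
    (T : E →L[𝕜] E) (n : ℕ) : E →L[𝕜] E :=
  (n : 𝕜)⁻¹ • ∑ k ∈ Finset.range n, T ^ k

/-- The identity map from the bounded operators on `E`, with the operator norm, to the same set
with the strong operator topology (the topology of pointwise norm convergence). -/
def toSOT {𝕜 : Type*} [RCLike 𝕜] {E : Type*} [NormedAddCommGroup E] [NormedSpace 𝕜 E] :
    (E →L[𝕜] E) ≃ (E →Lₚₜ[𝕜] E) :=
  UniformConvergenceCLM.ofFun (RingHom.id 𝕜) E {s : Set E | Finite s}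

/-- `T` is ergodic: its Cesàro means converge in the strong operator topology. -/
def IsErgodic {𝕜 : Type*} [RCLike 𝕜] {E : Type*} [NormedAddCommGroup E] [NormedSpace 𝕜 E]
    (T : E →L[𝕜] E) : Prop :=
  ∃ S : E →Lₚₜ[𝕜] E, Tendsto (fun n => toSOT (cesaro T n)) atTop (𝓝 S)

/-- `T` is uniformly ergodic: its Cesàro means converge in the operator norm. -/
def IsUniformlyErgodic {𝕜 : Type*} [RCLike 𝕜] {E : Type*} [NormedAddCommGroup E]
    [NormedSpace 𝕜 E] (T : E →L[𝕜] E) : Prop :=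
  ∃ S : E →L[𝕜] E, Tendsto (fun n => cesaro T n) atTop (𝓝 S)

variable (X : Type*) [NormedAddCommGroup X] [NormedSpace 𝕜 X]

/-- The subspace of `ℓ^∞(X)` of those bounded sequences whose norms tend to `0` along `U`. -/
def nullSeq (U : Ultrafilter ℕ) : Submodule 𝕜 (lp (fun _ : ℕ => X) ∞) where
  carrier := {x | Tendsto (fun n => ‖x n‖) U (𝓝 0)}
  zero_mem' := by simp
  add_mem' := by
    intro a b ha hb
    have h := Tendsto.add ha hb
    rw [add_zero] at h
    exact squeeze_zero (fun n => norm_nonneg _) (fun n => norm_add_le (a n) (b n)) h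
  smul_mem' := by
    intro c a ha
    have h := Tendsto.const_mul ‖c‖ ha
    rw [mul_zero] at h
    exact squeeze_zero (fun n => norm_nonneg _) (fun n => (norm_smul c (a n)).le) h

/-- Closedness makes the quotient seminorm on the ultrapower below a norm. -/
instance isClosed_nullSeq (U : Ultrafilter ℕ) :
    IsClosed (nullSeq 𝕜 X U : Set (lp (fun _ : ℕ => X) ∞)) := by
  refine isClosed_of_closure_subset fun x hx => ?_
  refine Metric.tendsto_nhds.2 fun ε hε => ?_
  obtain ⟨y, hy, hxy⟩ := Metric.mem_closure_iff.1 hx (ε / 2) (half_pos hε)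
  have hy' : Tendsto (fun n => ‖y n‖) U (𝓝 0) := hy
  filter_upwards [Metric.tendsto_nhds.1 hy' (ε / 2) (half_pos hε)] with n hn
  rw [Real.dist_eq, sub_zero, abs_of_nonneg (norm_nonneg _)] at hn ⊢
  have h1 : ‖(x - y) n‖ ≤ ‖x - y‖ := lp.norm_apply_le_norm (by simp) (x - y) n
  have h2 : ‖x n‖ ≤ ‖(x - y) n‖ + ‖y n‖ := by
    simpa using norm_add_le ((x - y) n) (y n)
  rw [dist_eq_norm] at hxy
  linarith

/-- The ultrapower `X_U = ℓ^∞(X) / {x : lim_U ‖x n‖ = 0}` with the quotient norm. -/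
abbrev Ultrapower (U : Ultrafilter ℕ) : Type _ :=
  lp (fun _ : ℕ => X) ∞ ⧸ nullSeq 𝕜 X U

variable {𝕜 X}

/-- The operator `(x n)_n ↦ (T (x n))_n` on `ℓ^∞(X)`. -/
def seqMap (T : X →L[𝕜] X) : lp (fun _ : ℕ => X) ∞ →L[𝕜] lp (fun _ : ℕ => X) ∞ :=
  lp.mapCLM ∞ (fun _ : ℕ => T) (norm_nonneg T) (fun _ => le_rfl)

theorem nullSeq_le_comap (T : X →L[𝕜] X) (U : Ultrafilter ℕ) :
    nullSeq 𝕜 X U ≤ (nullSeq 𝕜 X U).comap (seqMap T).toLinearMap := by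
  intro x hx
  have h := Tendsto.const_mul ‖T‖ (show Tendsto (fun n => ‖x n‖) U (𝓝 0) from hx)
  rw [mul_zero] at h
  exact squeeze_zero (fun n => norm_nonneg _) (fun n => T.le_opNorm (x n)) h

/-- The ultrapower operator `T_U : [(x n)_n] ↦ [(T (x n))_n]`. -/
def ultrapowerMap (T : X →L[𝕜] X) (U : Ultrafilter ℕ) :
    Ultrapower 𝕜 X U →L[𝕜] Ultrapower 𝕜 X U where
  toLinearMap := (nullSeq 𝕜 X U).mapQ (nullSeq 𝕜 X U) (seqMap T).toLinearMap
    (nullSeq_le_comap T U)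
  cont := continuous_quot_lift _ ((nullSeq 𝕜 X U).mkQL.continuous.comp (seqMap T).continuous)

/-- `T` is super-ergodic: all its ultrapowers along ultrafilters on `ℕ` are ergodic. -/
def IsSuperErgodic (T : X →L[𝕜] X) : Prop :=
  ∀ U : Ultrafilter ℕ, IsErgodic (ultrapowerMap T U)

variable (𝕜 X) in
/-- The set of super-ergodic operators on `X`, in the strong operator topology. -/
def superErgodicSet : Set (X →Lₚₜ[𝕜] X) := {T | IsSuperErgodic (toSOT.symm T)}

variable (𝕜 X) in
/-- The set of uniformly ergodic operators on `X`. -/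
def uniformlyErgodicSet : Set (X →Lₚₜ[𝕜] X) := {T | IsUniformlyErgodic (toSOT.symm T)}

/-- The entropy tree of `T` at `ε`: the finite strictly increasing sequences `s` of positive
integers of length at most `1`, or for which some `x` in the closed unit ball satisfies
`‖A_{s_p} x - A_{s_{p+1}} x‖ > ε` for any two consecutive entries. -/
def entropyTree (T : X →L[𝕜] X) (ε : ℝ) : Descriptive.tree ℕ :=
  ⟨{s | s.Pairwise (· < ·) ∧ (∀ n ∈ s, 0 < n) ∧
      (s.length ≤ 1 ∨ ∃ x : X, ‖x‖ ≤ 1 ∧ ∀ (p : ℕ) (hp : p + 1 < s.length),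
        ε < ‖cesaro T s[p] x - cesaro T s[p + 1] x‖)}, by
    rintro s a ⟨h1, h2, h3⟩
    refine ⟨(List.pairwise_append.1 h1).1, fun n hn => h2 n (by simp [hn]), ?_⟩
    rcases h3 with h | ⟨x, hx, h⟩
    · left
      rw [List.length_append] at h
      omega
    · refine Or.inr ⟨x, hx, fun p hp => ?_⟩
      have h' := h p (by rw [List.length_append]; omega)
      rwa [List.getElem_append_left (by omega), List.getElem_append_left hp] at h'⟩

end Operators

section Heights

/-- For nodes of a tree: `s` is a proper extension of `t`. -/
def Extends (T : Descriptive.tree ℕ) (s t : {s : List ℕ // s ∈ T}) : Prop :=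
  t.1.length < s.1.length ∧ t.1 <+: s.1

open scoped Classical in
/-- The height of a tree on `ℕ`: the supremum over its nodes `s` of `rank s + 1`, where `rank s` is
the supremum of `rank t + 1` over the proper extensions `t` of `s` in the tree, if the tree is well
founded; and `ω₁` otherwise. -/
def height (T : Descriptive.tree ℕ) : Ordinal.{0} :=
  if h : IsWellFounded {s : List ℕ // s ∈ T} (Extends T) then
    ⨆ s : {s : List ℕ // s ∈ T}, Order.succ (h.rank (Extends T) s)
  else ω₁

/-- The index `η_e(T) = sup_{ε > 0} h(A_e(T, ε))`. Heights never exceed `ω₁`, so all suprema of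
indices are genuine suprema of bounded families. -/
def eta {𝕜 : Type*} [RCLike 𝕜] {X : Type*} [NormedAddCommGroup X] [NormedSpace 𝕜 X]
    (T : X →Lₚₜ[𝕜] X) : Ordinal.{0} :=
  ⨆ ε : {ε : ℝ // 0 < ε}, height (entropyTree (toSOT.symm T) ε)

end Heights

section Coanalytic

variable {P : Type*} [TopologicalSpace P]

/-- A set is coanalytic if its complement is analytic. -/
def IsCoanalytic (C : Set P) : Prop := AnalyticSet Cᶜ

/-- `δ` is a coanalytic rank on `C`: `C` is coanalytic, `δ` takes countable ordinal values on `C`,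
and, when `δ` is given the value `∞` off `C`, the relations `x ∈ C ∧ δ x ≤ δ y` and
`x ∈ C ∧ δ x < δ y` are coanalytic in `P × P`. -/
structure IsCoanalyticRank (C : Set P) (δ : P → Ordinal.{0}) : Prop where
  coanalytic : IsCoanalytic C
  lt_omega_one : ∀ x ∈ C, δ x < ω₁
  coanalytic_le : IsCoanalytic {p : P × P | p.1 ∈ C ∧ (p.2 ∈ C → δ p.1 ≤ δ p.2)}
  coanalytic_lt : IsCoanalytic {p : P × P | p.1 ∈ C ∧ (p.2 ∈ C → δ p.1 < δ p.2)}

end Coanalytic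

end SuperErgodic

end

/-!
For a tree `A` on `ℕ` with a root, `height A` is the successor of the rank of the root, or `ω₁` if
`A` is ill-founded. The comparison `height A ≤ height B` then says that `B` *simulates* `A`: there
is a relation between lists that relates the roots and along which every proper extension in `A`
is matched by one in `B` (`height_le_height_iff`). Relations between lists form a Polish space, so
this is an analytic condition on `A` and `B`; so is `height A < height B ∨ height B = ω₁`.

The trees link to ergodic theory as follows. An infinite branch of an entropy tree of `T` gives
vectors whose class in a free ultrapower has Cesàro means that are not Cauchy. Conversely, if the
trees are well founded and a bounded sequence is given, a node that is maximal among those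
witnessed almost everywhere bounds the later oscillation of the Cesàro means at its class; with
the Banach–Steinhaus theorem this gives ergodicity of the ultrapower. So `T` is super-ergodic if
and only if all its trees are well founded, that is, `eta T < ω₁` (`mem_superErgodicSet_iff`). For
uniformly ergodic `T` the lengths of the nodes of each tree are bounded, and `eta T ≤ ω`.

The space `L(X)` with the strong operator topology is a continuous image of the Baire space
(`exists_continuous_surjective_baire`), and the nodes of the entropy tree depend on the operator
in a Borel way (`measurableSet_mem_entropyTree`). The index is a countable supremum of heights,
and heights are successors unless they are `ω₁`; hence `eta S ≤ eta T`, and `eta S < eta T ∨ eta T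
= ω₁`, are countable combinations of comparisons of heights, and analytic. These are the
complements of the relations in the definition of a coanalytic rank.

If the index is bounded below `ω₁` on the super-ergodic operators, their set is Borel because, for
a countable ordinal `β`, having rank at most `β` is a Borel property (`measurableSet_rank_le`). If
the set is Borel, the boundedness principle for analytic sets of well-founded trees
(`exists_rank_le_of_continuous`) bounds the index.
-/

namespace SuperErgodic

/-! ### Ranks, simulations and heights of trees -/

theorem rank_le_iff {α : Type*} {r : α → α → Prop} {a : α} (h : Acc r a) {o : Ordinal} :
    h.rank ≤ o ↔ ∀ b (hb : r b a), (h.inv hb).rank < o := by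
  rw [h.rank_eq, Ordinal.iSup_le_iff]
  simp

theorem lt_rank_iff {α : Type*} {r : α → α → Prop} {a : α} (h : Acc r a) {o : Ordinal} :
    o < h.rank ↔ ∃ b, ∃ hb : r b a, o ≤ (h.inv hb).rank := by
  rw [← not_le, rank_le_iff]
  simp

theorem rank_lt_omega_one {α : Type*} [Countable α] {r : α → α → Prop} {a : α} (h : Acc r a) :
    h.rank < ω₁ := by
  induction h with
  | intro a h ih =>
    rw [Acc.rank_eq]
    refine Ordinal.iSup_lt_omega_one fun b => ?_
    exact (Cardinal.isSuccLimit_omega 1).succ_lt (ih b.1 b.2)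

/-- Accessibility is reflected by a relation `R` along which every descent of `r` is matched by one
of `q`. -/
theorem acc_of_simulation {α β : Type*} {r : α → α → Prop} {q : β → β → Prop} {R : α → β → Prop}
    (hR : ∀ a b, R a b → ∀ a', r a' a → ∃ b', q b' b ∧ R a' b') {b : β} (hb : Acc q b) :
    ∀ {a : α}, R a b → Acc r a := by
  induction hb with
  | intro b _ ih =>
    intro a hab
    refine ⟨a, fun a' ha' => ?_⟩
    obtain ⟨b', hb', h'⟩ := hR a b hab a' ha'
    exact ih b' hb' h'

theorem rank_le_of_simulation.{u} {α β : Type u} {r : α → α → Prop} {q : β → β → Prop}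
    {R : α → β → Prop}
    (hR : ∀ a b, R a b → ∀ a', r a' a → ∃ b', q b' b ∧ R a' b') {b : β} (hb : Acc q b) :
    ∀ {a : α} (_ : R a b) (ha : Acc r a), ha.rank ≤ hb.rank := by
  induction hb with
  | intro b hb ih =>
    intro a hab ha
    rw [rank_le_iff]
    intro a' ha'
    obtain ⟨b', hb', h'⟩ := hR a b hab a' ha'
    exact (ih b' hb' h' (ha.inv ha')).trans_lt (Acc.rank_lt_of_rel (Acc.intro b hb) hb')

/-- `ExtendsIn A s' s`: the list `s'` belongs to `A` and properly extends `s`. In contrast to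
`Extends` this is a relation on all lists, so that it makes sense for varying `A` on one type. -/
def ExtendsIn (A : Set (List ℕ)) (s' s : List ℕ) : Prop :=
  s' ∈ A ∧ s.length < s'.length ∧ s <+: s'

theorem acc_extendsIn_iff (A : Descriptive.tree ℕ) (s : {s : List ℕ // s ∈ A}) :
    Acc (ExtendsIn (A : Set (List ℕ))) s ↔ Acc (Extends A) s := by
  constructor
  · intro h
    exact acc_of_simulation (R := fun (a : {s : List ℕ // s ∈ A}) (b : List ℕ) => a.1 = b)
      (q := ExtendsIn (A : Set (List ℕ)))
      (fun a b hab a' h' => ⟨a'.1, ⟨a'.2, hab ▸ h'⟩, rfl⟩) h rfl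
  · intro h
    exact acc_of_simulation (R := fun (b : List ℕ) (a : {s : List ℕ // s ∈ A}) => a.1 = b)
      (q := Extends A)
      (fun b a hab b' h' => ⟨⟨b', h'.1⟩, hab ▸ h'.2, rfl⟩) h rfl

theorem rank_extendsIn (A : Descriptive.tree ℕ) (s : {s : List ℕ // s ∈ A})
    (h : Acc (ExtendsIn (A : Set (List ℕ))) s) (h' : Acc (Extends A) s) : h'.rank = h.rank := by
  apply le_antisymm
  · exact rank_le_of_simulation
      (R := fun (a : {s : List ℕ // s ∈ A}) (b : List ℕ) => a.1 = b)
      (fun a b hab a' h' => ⟨a'.1, ⟨a'.2, hab ▸ h'⟩, rfl⟩) h rfl h'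
  · exact rank_le_of_simulation (R := fun (b : List ℕ) (a : {s : List ℕ // s ∈ A}) => a.1 = b)
      (fun b a hab b' h' => ⟨⟨b', h'.1⟩, hab ▸ h'.2, rfl⟩) h' rfl h

theorem isWellFounded_extends_iff {A : Descriptive.tree ℕ} (hA : [] ∈ A) :
    IsWellFounded _ (Extends A) ↔ Acc (ExtendsIn (A : Set (List ℕ))) [] := by
  rw [acc_extendsIn_iff A ⟨[], hA⟩]
  refine ⟨fun h => h.apply _ _, fun h => ⟨⟨fun s => ?_⟩⟩⟩
  by_cases hs : s.1 = []
  · convert h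
  · exact h.inv ⟨by simpa [List.length_pos_iff] using hs, List.nil_prefix⟩

theorem height_of_acc {A : Descriptive.tree ℕ} (hA : [] ∈ A)
    (h : Acc (ExtendsIn (A : Set (List ℕ))) []) : height A = Order.succ h.rank := by
  have hw := (isWellFounded_extends_iff hA).2 h
  rw [height, dif_pos hw]
  have hr : hw.rank (Extends A) ⟨[], hA⟩ = h.rank := rank_extendsIn A ⟨[], hA⟩ h _
  apply le_antisymm
  · refine Ordinal.iSup_le fun s => Order.succ_le_succ ?_
    rw [← hr]
    by_cases hs : s.1 = []
    · exact (congrArg (hw.rank (Extends A)) (Subtype.ext hs : s = ⟨[], hA⟩)).le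
    · exact (hw.rank_lt_of_rel
        ⟨by simpa [List.length_pos_iff] using hs, List.nil_prefix⟩).le
  · rw [← hr]
    exact Ordinal.le_iSup (fun s => Order.succ (hw.rank (Extends A) s)) ⟨[], hA⟩

theorem height_of_not_acc {A : Descriptive.tree ℕ} (hA : [] ∈ A)
    (h : ¬ Acc (ExtendsIn (A : Set (List ℕ))) []) : height A = ω₁ := by
  rw [height, dif_neg]
  rwa [isWellFounded_extends_iff hA]

theorem height_lt_omega_one_iff {A : Descriptive.tree ℕ} (hA : [] ∈ A) :
    height A < ω₁ ↔ Acc (ExtendsIn (A : Set (List ℕ))) [] := by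
  constructor
  · intro h
    by_contra h'
    exact h.ne (height_of_not_acc hA h')
  · intro h
    rw [height_of_acc hA h]
    exact (Cardinal.isSuccLimit_omega 1).succ_lt (rank_lt_omega_one h)

theorem height_le_omega_one {A : Descriptive.tree ℕ} (hA : [] ∈ A) : height A ≤ ω₁ := by
  by_cases h : Acc (ExtendsIn (A : Set (List ℕ))) []
  · exact ((height_lt_omega_one_iff hA).2 h).le
  · exact (height_of_not_acc hA h).le

/-- `R` (a relation on lists, given by its characteristic function) is a simulation of `A` by `B`:
whenever `R` relates `s` to `t`, every proper extension of `s` in `A` is related to some proper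
extension of `t` in `B`. -/
def IsSimulation (A B : Set (List ℕ)) (R : List ℕ × List ℕ → Bool) : Prop :=
  ∀ s t, R (s, t) = true → ∀ s', ExtendsIn A s' s → ∃ t', ExtendsIn B t' t ∧ R (s', t') = true

/-- The largest simulation: `s` is related to `t` if the rank of `t` in `B` is at least that of `s`
in `A`, the rank being infinite where the tree is ill-founded. -/
theorem exists_isSimulation (A B : Set (List ℕ)) : ∃ R, IsSimulation A B R ∧
    ∀ s t, R (s, t) = true ↔ ∀ ht : Acc (ExtendsIn B) t, ∃ hs : Acc (ExtendsIn A) s,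
      hs.rank ≤ ht.rank := by
  classical
  refine ⟨fun p => decide (∀ ht : Acc (ExtendsIn B) p.2, ∃ hs : Acc (ExtendsIn A) p.1,
      hs.rank ≤ ht.rank), ?_, fun s t => by simp⟩
  intro s t hst s' hs'
  simp only [decide_eq_true_eq] at hst ⊢
  by_cases ht : Acc (ExtendsIn B) t
  · obtain ⟨hs, hle⟩ := hst ht
    obtain ⟨t', ht', hle'⟩ := (lt_rank_iff ht).1 ((Acc.rank_lt_of_rel hs hs').trans_le hle)
    exact ⟨t', ht', fun _ => ⟨hs.inv hs', hle'⟩⟩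
  · -- an inaccessible node has an inaccessible extension
    have : ∃ t', ExtendsIn B t' t ∧ ¬ Acc (ExtendsIn B) t' := by
      by_contra! h
      exact ht ⟨_, h⟩
    obtain ⟨t', ht', hn⟩ := this
    exact ⟨t', ht', fun h => absurd h hn⟩

theorem height_le_height_iff {A B : Descriptive.tree ℕ} (hA : [] ∈ A) (hB : [] ∈ B) :
    height A ≤ height B ↔ ∃ R, IsSimulation A B R ∧ R ([], []) = true := by
  constructor
  · intro h
    obtain ⟨R, hR, hR'⟩ := exists_isSimulation A B
    refine ⟨R, hR, (hR' _ _).2 fun hb => ?_⟩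
    have ha := (height_lt_omega_one_iff hA).1 (h.trans_lt ((height_lt_omega_one_iff hB).2 hb))
    rw [height_of_acc hA ha, height_of_acc hB hb] at h
    exact ⟨ha, Order.succ_le_succ_iff.1 h⟩
  · rintro ⟨R, hR, h0⟩
    by_cases hb : Acc (ExtendsIn (B : Set (List ℕ))) []
    · have ha : Acc (ExtendsIn (A : Set (List ℕ))) [] := acc_of_simulation hR hb h0
      rw [height_of_acc hA ha, height_of_acc hB hb]
      exact Order.succ_le_succ (rank_le_of_simulation hR hb h0 ha)
    · rw [height_of_not_acc hB hb]
      exact height_le_omega_one hA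

/-- The right-hand side is analytic in `A` and `B`, which the strict inequality alone would not be:
the ill-founded `B` have to be added. -/
theorem height_lt_height_iff {A B : Descriptive.tree ℕ} (hA : [] ∈ A) (hB : [] ∈ B) :
    (height A < height B ∨ height B = ω₁) ↔
      ∃ R, IsSimulation A B R ∧ ∃ t, ExtendsIn B t [] ∧ R ([], t) = true := by
  constructor
  · intro h
    obtain ⟨R, hR, hR'⟩ := exists_isSimulation A B
    refine ⟨R, hR, ?_⟩
    by_cases hb : Acc (ExtendsIn (B : Set (List ℕ))) []
    · have hlt := h.resolve_right ((height_lt_omega_one_iff hB).2 hb).ne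
      have ha := (height_lt_omega_one_iff hA).1 (hlt.trans ((height_lt_omega_one_iff hB).2 hb))
      rw [height_of_acc hA ha, height_of_acc hB hb, Order.succ_lt_succ_iff] at hlt
      obtain ⟨t, ht, hle⟩ := (lt_rank_iff hb).1 hlt
      exact ⟨t, ht, (hR' _ _).2 fun _ => ⟨ha, hle⟩⟩
    · have : ∃ t, ExtendsIn (B : Set (List ℕ)) t [] ∧ ¬ Acc (ExtendsIn (B : Set (List ℕ))) t := by
        by_contra! h
        exact hb ⟨_, h⟩
      obtain ⟨t, ht, hn⟩ := this
      exact ⟨t, ht, (hR' _ _).2 fun h => absurd h hn⟩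
  · rintro ⟨R, hR, t, ht, h0⟩
    by_cases hb : Acc (ExtendsIn (B : Set (List ℕ))) []
    · have ha : Acc (ExtendsIn (A : Set (List ℕ))) [] := acc_of_simulation hR (hb.inv ht) h0
      left
      rw [height_of_acc hA ha, height_of_acc hB hb, Order.succ_lt_succ_iff]
      exact (rank_le_of_simulation hR (hb.inv ht) h0 ha).trans_lt (Acc.rank_lt_of_rel hb ht)
    · exact Or.inr (height_of_not_acc hB hb)

theorem height_mono {A B : Descriptive.tree ℕ} (hA : [] ∈ A) (hB : [] ∈ B)
    (h : ∀ s ∈ A, s ∈ B) : height A ≤ height B := by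
  classical
  refine (height_le_height_iff hA hB).2 ⟨fun p => decide (p.1 = p.2), ?_, by simp⟩
  intro s t hst s' hs'
  obtain rfl : s = t := by simpa using hst
  exact ⟨s', ⟨h _ hs'.1, hs'.2⟩, by simp⟩

/-! ### The index and super-ergodicity -/

theorem le_getElem_of_pairwise_lt {s : List ℕ} (hs : s.Pairwise (· < ·)) (p : ℕ)
    (hp : p < s.length) : p ≤ s[p] := by
  induction p with
  | zero => exact Nat.zero_le _
  | succ p ih =>
    exact Nat.succ_le_of_lt ((ih (by omega)).trans_lt
      (List.pairwise_iff_getElem.1 hs p (p + 1) (by omega) hp (by omega)))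

section Ergodic

variable {𝕜 : Type*} [RCLike 𝕜] {X : Type*} [NormedAddCommGroup X] [NormedSpace 𝕜 X]

theorem nil_mem_entropyTree (T : X →L[𝕜] X) (ε : ℝ) : [] ∈ entropyTree T ε :=
  ⟨List.Pairwise.nil, by simp, Or.inl (by simp)⟩

theorem entropyTree_anti (T : X →L[𝕜] X) {ε δ : ℝ} (h : ε ≤ δ) (s : List ℕ)
    (hs : s ∈ entropyTree T δ) : s ∈ entropyTree T ε := by
  obtain ⟨h1, h2, h3⟩ := hs
  refine ⟨h1, h2, h3.imp_right ?_⟩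
  rintro ⟨x, hx, hp⟩
  exact ⟨x, hx, fun p hp' => h.trans_lt (hp p hp')⟩

/-- The entropy tree of `T` at scale `1 / (n + 1)`. -/
noncomputable def scaleTree (T : X →Lₚₜ[𝕜] X) (n : ℕ) : Descriptive.tree ℕ :=
  entropyTree (toSOT.symm T) (1 / (n + 1))

theorem nil_mem_scaleTree (T : X →Lₚₜ[𝕜] X) (n : ℕ) : [] ∈ scaleTree T n :=
  nil_mem_entropyTree _ _

theorem height_le_eta (T : X →Lₚₜ[𝕜] X) (n : ℕ) : height (scaleTree T n) ≤ eta T := by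
  refine le_ciSup (f := fun ε : {ε : ℝ // 0 < ε} => height (entropyTree (toSOT.symm T) ε))
    ⟨ω₁, ?_⟩ ⟨1 / (n + 1), Nat.one_div_pos_of_nat⟩
  rintro _ ⟨ε, rfl⟩
  exact height_le_omega_one (nil_mem_entropyTree _ _)

theorem eta_eq_iSup (T : X →Lₚₜ[𝕜] X) : eta T = ⨆ n, height (scaleTree T n) := by
  apply le_antisymm
  · have : Nonempty {ε : ℝ // 0 < ε} := ⟨⟨1, one_pos⟩⟩
    refine ciSup_le fun ε => ?_
    obtain ⟨n, hn⟩ := exists_nat_one_div_lt ε.2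
    exact (height_mono (nil_mem_entropyTree _ _) (nil_mem_entropyTree _ _)
      (entropyTree_anti _ hn.le)).trans (Ordinal.le_iSup (fun n => height (scaleTree T n)) n)
  · exact Ordinal.iSup_le (height_le_eta T)

theorem eta_le_omega_one (T : X →Lₚₜ[𝕜] X) : eta T ≤ ω₁ := by
  rw [eta_eq_iSup]
  exact Ordinal.iSup_le fun n => height_le_omega_one (nil_mem_scaleTree _ _)

theorem eta_lt_omega_one_iff (T : X →Lₚₜ[𝕜] X) :
    eta T < ω₁ ↔ ∀ n, height (scaleTree T n) < ω₁ := by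
  constructor
  · exact fun h n => (height_le_eta T n).trans_lt h
  · intro h
    rw [eta_eq_iSup]
    exact Ordinal.iSup_lt_omega_one h

/-- Heights of trees are successors or `ω₁`, so they stay below a countable supremum only by
staying below one of its terms. -/
theorem eta_le_eta_iff (S T : X →Lₚₜ[𝕜] X) :
    eta S ≤ eta T ↔ ∀ n, ∃ m, height (scaleTree S n) ≤ height (scaleTree T m) := by
  constructor
  · intro h n
    by_cases hn : Acc (ExtendsIn (scaleTree S n : Set (List ℕ))) []
    · have hle := (height_le_eta S n).trans h
      rw [height_of_acc (nil_mem_scaleTree S n) hn, Order.succ_le_iff, eta_eq_iSup,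
        Ordinal.lt_iSup_iff] at hle
      obtain ⟨m, hm⟩ := hle
      refine ⟨m, ?_⟩
      rwa [height_of_acc (nil_mem_scaleTree S n) hn, Order.succ_le_iff]
    · by_contra! hlt
      have hS := height_of_not_acc (nil_mem_scaleTree S n) hn
      have hT : eta T < ω₁ := (eta_lt_omega_one_iff T).2 fun m => hS ▸ hlt m
      exact absurd ((height_le_eta S n).trans h) (hS ▸ hT).not_ge
  · intro h
    rw [eta_eq_iSup S]
    refine Ordinal.iSup_le fun n => ?_
    obtain ⟨m, hm⟩ := h n
    exact hm.trans (height_le_eta T m)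

/-- The case `eta T = ω₁` is included to keep the condition analytic, as in `height_lt_height_iff`.
-/
theorem eta_lt_eta_iff (S T : X →Lₚₜ[𝕜] X) :
    (eta S < eta T ∨ eta T = ω₁) ↔ ∃ m, ∀ n,
      height (scaleTree S n) < height (scaleTree T m) ∨ height (scaleTree T m) = ω₁ := by
  constructor
  · intro h
    by_cases hT : eta T = ω₁
    · have : ¬ eta T < ω₁ := hT.not_lt
      rw [eta_lt_omega_one_iff] at this
      push Not at this
      obtain ⟨m, hm⟩ := this
      exact ⟨m, fun _ => Or.inr (le_antisymm (height_le_omega_one (nil_mem_scaleTree T m)) hm)⟩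
    · have hlt := h.resolve_right hT
      rw [eta_eq_iSup T, Ordinal.lt_iSup_iff] at hlt
      obtain ⟨m, hm⟩ := hlt
      exact ⟨m, fun n => Or.inl ((height_le_eta S n).trans_lt hm)⟩
  · rintro ⟨m, hm⟩
    by_cases hT : eta T = ω₁
    · exact Or.inr hT
    · left
      have hT' := (eta_lt_omega_one_iff T).1 (lt_of_le_of_ne (eta_le_omega_one T) hT) m
      have hacc := (height_lt_omega_one_iff (nil_mem_scaleTree T m)).1 hT'
      refine lt_of_lt_of_le ?_ (height_le_eta T m)
      have hlt := fun n => (hm n).resolve_right hT'.ne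
      rw [height_of_acc (nil_mem_scaleTree T m) hacc] at hlt ⊢
      rw [eta_eq_iSup, Order.lt_succ_iff]
      exact Ordinal.iSup_le fun n => Order.lt_succ_iff.1 (hlt n)

theorem cesaro_apply (T : X →L[𝕜] X) (n : ℕ) (x : X) :
    cesaro T n x = (n : 𝕜)⁻¹ • ∑ k ∈ Finset.range n, (T ^ k) x := by
  simp [cesaro]

theorem seqMap_pow_apply (T : X →L[𝕜] X) (k : ℕ) (x : lp (fun _ : ℕ => X) ∞) (i : ℕ) :
    (seqMap T ^ k) x i = (T ^ k) (x i) := by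
  induction k with
  | zero => rfl
  | succ k ih =>
    rw [pow_succ', pow_succ']
    change T ((seqMap T ^ k) x i) = T ((T ^ k) (x i))
    rw [ih]

theorem cesaro_seqMap_apply (T : X →L[𝕜] X) (n : ℕ) (x : lp (fun _ : ℕ => X) ∞) (i : ℕ) :
    cesaro (seqMap T) n x i = cesaro T n (x i) := by
  rw [cesaro_apply, cesaro_apply, lp.coeFn_smul, Pi.smul_apply, lp.coeFn_sum, Finset.sum_apply]
  simp_rw [seqMap_pow_apply]

theorem cesaro_ultrapowerMap_mk (T : X →L[𝕜] X) (U : Ultrafilter ℕ) (n : ℕ)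
    (x : lp (fun _ : ℕ => X) ∞) :
    cesaro (ultrapowerMap T U) n ((nullSeq 𝕜 X U).mkQ x) =
      (nullSeq 𝕜 X U).mkQ (cesaro (seqMap T) n x) := by
  have hk : ∀ k, (ultrapowerMap T U ^ k) ((nullSeq 𝕜 X U).mkQ x) =
      (nullSeq 𝕜 X U).mkQ ((seqMap T ^ k) x) := by
    intro k
    induction k with
    | zero => rfl
    | succ k ih =>
      rw [pow_succ', pow_succ']
      change ultrapowerMap T U ((ultrapowerMap T U ^ k) _) = _
      rw [ih]
      rfl
  rw [cesaro_apply, cesaro_apply, map_smul, map_sum]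
  simp_rw [hk]

theorem le_norm_mkQ (U : Ultrafilter ℕ) (x : lp (fun _ : ℕ => X) ∞) {ε : ℝ}
    (h : ∀ᶠ i in (U : Filter ℕ), ε ≤ ‖x i‖) : ε ≤ ‖(nullSeq 𝕜 X U).mkQ x‖ := by
  refine le_of_forall_pos_lt_add fun δ hδ => ?_
  obtain ⟨y, hy, hlt⟩ := Submodule.Quotient.norm_mk_lt ((nullSeq 𝕜 X U).mkQ x) (half_pos hδ)
  have hmem : x - y ∈ nullSeq 𝕜 X U := by
    rw [← Submodule.Quotient.mk_eq_zero, Submodule.Quotient.mk_sub, hy]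
    simp
  have hn : Tendsto (fun n => ‖(x - y) n‖) U (𝓝 0) := hmem
  obtain ⟨i, hi, hi'⟩ := (h.and (hn.eventually (gt_mem_nhds (half_pos hδ)))).exists
  have h1 : ‖y i‖ ≤ ‖y‖ := lp.norm_apply_le_norm (by simp) y i
  have h2 : ‖x i‖ ≤ ‖(x - y) i‖ + ‖y i‖ := by
    simpa using norm_add_le ((x - y) i) (y i)
  linarith

theorem norm_mkQ_le (U : Ultrafilter ℕ) (x : lp (fun _ : ℕ => X) ∞) {ε : ℝ} (hε : 0 ≤ ε)
    (h : ∀ᶠ i in (U : Filter ℕ), ‖x i‖ ≤ ε) : ‖(nullSeq 𝕜 X U).mkQ x‖ ≤ ε := by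
  classical
  -- truncating the large entries of `x` does not change its class
  have hy : Memℓp (fun i => if ‖x i‖ ≤ ε then x i else 0) ∞ := by
    refine memℓp_infty ⟨ε, ?_⟩
    rintro _ ⟨i, rfl⟩
    dsimp only
    split_ifs with hi
    · exact hi
    · simpa using hε
  let y : lp (fun _ : ℕ => X) ∞ := ⟨_, hy⟩
  have hxy : (nullSeq 𝕜 X U).mkQ x = (nullSeq 𝕜 X U).mkQ y := by
    refine (Submodule.Quotient.eq _).2 ?_
    refine tendsto_const_nhds.congr' ?_
    filter_upwards [h] with i hi
    have : y i = x i := if_pos hi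
    simp [this]
  rw [hxy]
  refine (Submodule.Quotient.norm_mk_le _ y).trans (lp.norm_le_of_forall_le hε fun i => ?_)
  change ‖if ‖x i‖ ≤ ε then x i else 0‖ ≤ ε
  split_ifs with hi
  · exact hi
  · simpa using hε

theorem IsErgodic.cauchySeq {T : X →L[𝕜] X} (h : IsErgodic T) (x : X) :
    CauchySeq fun n => cesaro T n x := by
  obtain ⟨S, hS⟩ := h
  exact ((PointwiseConvergenceCLM.tendsto_iff_forall_tendsto.1 hS) x).cauchySeq

theorem isErgodic_of_cauchySeq [CompleteSpace X] {T : X →L[𝕜] X}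
    (h : ∀ x, CauchySeq fun n => cesaro T n x) : IsErgodic T := by
  choose f hf using fun x => cauchySeq_tendsto_of_complete (h x)
  exact ⟨toSOT (continuousLinearMapOfTendsto (cesaro T) (tendsto_pi_nhds.2 hf)),
    PointwiseConvergenceCLM.tendsto_iff_forall_tendsto.2 hf⟩

/-- A node of the entropy tree that is maximal among those witnessed `U`-almost everywhere by a
given sequence bounds the oscillation of the Cesàro means at the class of that sequence. -/
theorem cauchySeq_of_wellFounded (T : X →L[𝕜] X) (U : Ultrafilter ℕ)
    (hT : ∀ ε > 0, Acc (ExtendsIn (entropyTree T ε : Set (List ℕ))) [])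
    (x : lp (fun _ : ℕ => X) ∞) (hx : ∀ i, ‖x i‖ ≤ 1) :
    CauchySeq fun n => cesaro (ultrapowerMap T U) n ((nullSeq 𝕜 X U).mkQ x) := by
  refine Metric.cauchySeq_iff'.2 fun δ hδ => ?_
  have hwf := ((isWellFounded_extends_iff (nil_mem_entropyTree T (δ / 2))).2
    (hT _ (half_pos hδ))).wf
  let good : Set {s : List ℕ // s ∈ entropyTree T (δ / 2)} := {s | s.1 ≠ [] ∧
    ∀ᶠ i in (U : Filter ℕ), ∀ (p : ℕ) (hp : p + 1 < s.1.length),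
        δ / 2 < ‖cesaro T s.1[p] (x i) - cesaro T s.1[p + 1] (x i)‖}
  have hne : good.Nonempty :=
    ⟨⟨[1], by simp, by simp, Or.inl (by simp)⟩, by simp, by simp⟩
  obtain ⟨⟨s, hs⟩, ⟨hs0, hsU⟩, hmin⟩ := hwf.has_min good hne
  dsimp only at hs0 hsU
  refine ⟨s.getLast hs0, fun m hm => ?_⟩
  rcases hm.eq_or_lt with rfl | hm
  · simpa using hδ
  refine lt_of_le_of_lt ?_ (half_lt_self hδ)
  rw [dist_eq_norm, cesaro_ultrapowerMap_mk, cesaro_ultrapowerMap_mk, ← map_sub]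
  refine norm_mkQ_le U _ (half_pos hδ).le ?_
  by_contra hcon
  rw [Ultrafilter.eventually_not.symm] at hcon
  have hall : ∀ᶠ i in (U : Filter ℕ), ∀ (p : ℕ) (hp : p + 1 < (s ++ [m]).length),
      δ / 2 < ‖cesaro T (s ++ [m])[p] (x i) - cesaro T (s ++ [m])[p + 1] (x i)‖ := by
    filter_upwards [hcon, hsU] with i hi hi' p hp
    rw [List.length_append, List.length_singleton] at hp
    rcases Nat.lt_or_ge (p + 1) s.length with h | h
    · rw [List.getElem_append_left (by omega), List.getElem_append_left h]
      exact hi' p h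
    · have hp' : p = s.length - 1 := by omega
      have hpos := List.length_pos_iff.2 hs0
      have h1 : (s ++ [m])[p + 1] = m := by
        rw [List.getElem_append_right h]
        simp
      have h2 : (s ++ [m])[p] = s.getLast hs0 := by
        rw [List.getElem_append_left (by omega), List.getLast_eq_getElem]
        simp [hp']
      rw [h1, h2, norm_sub_rev]
      simpa [cesaro_seqMap_apply] using hi
  obtain ⟨i, hi⟩ := hall.exists
  have hlast : ∀ a ∈ s, a < m := by
    intro a ha
    refine lt_of_le_of_lt ?_ hm
    have hd := List.dropLast_append_getLast hs0
    rw [← hd, List.mem_append, List.mem_singleton] at ha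
    rcases ha with ha | ha
    · have h1 := hs.1
      rw [← hd] at h1
      exact ((List.pairwise_append.1 h1).2.2 a ha _ (by simp)).le
    · exact ha.le
  have hmem : s ++ [m] ∈ entropyTree T (δ / 2) := by
    refine ⟨List.pairwise_append.2 ⟨hs.1, by simp, ?_⟩, ?_, Or.inr ⟨x i, hx i, hi⟩⟩
    · intro a ha b hb
      rw [List.mem_singleton] at hb
      exact hb ▸ hlast a ha
    · intro n hn
      rcases List.mem_append.1 hn with hn | hn
      · exact hs.2.1 n hn
      · rw [List.mem_singleton] at hn
        omega
  exact hmin ⟨s ++ [m], hmem⟩ ⟨by simp, hall⟩ ⟨by simp, List.prefix_append _ _⟩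

theorem isSuperErgodic_of_wellFounded [CompleteSpace X] (T : X →L[𝕜] X)
    (hT : ∀ ε > 0, Acc (ExtendsIn (entropyTree T ε : Set (List ℕ))) []) : IsSuperErgodic T := by
  intro U
  refine isErgodic_of_cauchySeq fun z => ?_
  obtain ⟨x, rfl⟩ := (nullSeq 𝕜 X U).mkQ_surjective z
  -- reduce to a sequence in the unit ball
  have hc : (0 : ℝ) < ‖x‖ + 1 := by positivity
  have hc' : ((‖x‖ + 1 : ℝ) : 𝕜) ≠ 0 := by exact_mod_cast hc.ne'
  have hy := cauchySeq_of_wellFounded T U hT ((((‖x‖ + 1 : ℝ) : 𝕜)⁻¹) • x) (fun i => by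
    have h1 : ‖x i‖ ≤ ‖x‖ := lp.norm_apply_le_norm (by simp) x i
    rw [lp.coeFn_smul, Pi.smul_apply, norm_smul, norm_inv, RCLike.norm_ofReal, abs_of_pos hc,
      inv_mul_le_iff₀ hc]
    linarith)
  have := (uniformContinuous_const_smul ((‖x‖ + 1 : ℝ) : 𝕜)).comp_cauchySeq hy
  convert this using 2 with n
  rw [Function.comp_apply, ← map_smul, ← map_smul, smul_smul, mul_inv_cancel₀ hc', one_smul]

/-- An infinite branch of an entropy tree gives a sequence of witnesses, whose class in a free
ultrapower has Cesàro means that are not Cauchy. -/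
theorem wellFounded_of_isSuperErgodic {T : X →L[𝕜] X} (hT : IsSuperErgodic T) {ε : ℝ}
    (hε : 0 < ε) : Acc (ExtendsIn (entropyTree T ε : Set (List ℕ))) [] := by
  rw [← isWellFounded_extends_iff (nil_mem_entropyTree T ε)]
  refine ⟨?_⟩
  rw [wellFounded_iff_isEmpty_descending_chain]
  refine ⟨fun ⟨f, hstep⟩ => ?_⟩
  have hlen : ∀ j, j ≤ (f j).1.length := by
    intro j
    induction j with
    | zero => exact Nat.zero_le _
    | succ j ih => exact Nat.succ_le_of_lt (ih.trans_lt (hstep j).1)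
  have hpre : ∀ j k, j ≤ k → (f j).1 <+: (f k).1 := by
    intro j k h
    induction k, h using Nat.le_induction with
    | base => exact List.prefix_rfl
    | succ k _ ih => exact ih.trans (hstep k).2
  have hwit : ∀ j, ∃ x : X, ‖x‖ ≤ 1 ∧ ∀ (p : ℕ) (hp : p + 1 < (f j).1.length),
        ε < ‖cesaro T (f j).1[p] x - cesaro T (f j).1[p + 1] x‖ := by
    intro j
    rcases (f j).2.2.2 with h | h
    · exact ⟨0, by simp, fun p hp => by omega⟩
    · exact h
  choose x hx hxj using hwit
  have hmem : Memℓp x ∞ := memℓp_infty ⟨1, by rintro _ ⟨i, rfl⟩; exact hx i⟩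
  let z : lp (fun _ : ℕ => X) ∞ := ⟨x, hmem⟩
  obtain ⟨N, hN⟩ := Metric.cauchySeq_iff.1
    ((hT (hyperfilter ℕ)).cauchySeq ((nullSeq 𝕜 X (hyperfilter ℕ)).mkQ z)) ε hε
  have hN2 := hlen (N + 2)
  have hge : ∀ p (hp : p < (f (N + 2)).1.length), p ≤ (f (N + 2)).1[p] :=
    fun p hp => le_getElem_of_pairwise_lt (f (N + 2)).2.1 p hp
  have hlt := hN _ (hge N (by omega)) _ ((Nat.le_succ N).trans (hge (N + 1) (by omega)))
  rw [dist_eq_norm, cesaro_ultrapowerMap_mk, cesaro_ultrapowerMap_mk, ← map_sub] at hlt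
  refine hlt.not_ge (le_norm_mkQ _ _ ?_)
  have hcof : ∀ᶠ j in (hyperfilter ℕ : Filter ℕ), N + 2 ≤ j :=
    (Nat.hyperfilter_le_atTop) (eventually_ge_atTop (N + 2))
  filter_upwards [hcof] with j hj
  have hp := hpre _ _ hj
  have hl := hp.length_le
  have := hxj j N (by omega)
  rw [← hp.getElem (by omega), ← hp.getElem (by omega)] at this
  simpa [cesaro_seqMap_apply] using this.le

theorem mem_superErgodicSet_iff [CompleteSpace X] (T : X →Lₚₜ[𝕜] X) :
    T ∈ superErgodicSet 𝕜 X ↔ eta T < ω₁ := by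
  rw [eta_lt_omega_one_iff]
  constructor
  · intro h n
    rw [height_lt_omega_one_iff (nil_mem_scaleTree T n)]
    exact wellFounded_of_isSuperErgodic h Nat.one_div_pos_of_nat
  · intro h
    refine isSuperErgodic_of_wellFounded _ fun ε hε => ?_
    obtain ⟨n, hn⟩ := exists_nat_one_div_lt hε
    rw [← height_lt_omega_one_iff (nil_mem_entropyTree _ _)]
    exact (height_mono (nil_mem_entropyTree _ _) (nil_mem_entropyTree _ _)
      (entropyTree_anti _ hn.le)).trans_lt (h n)

theorem eta_eq_omega_one_iff [CompleteSpace X] (T : X →Lₚₜ[𝕜] X) :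
    eta T = ω₁ ↔ T ∉ superErgodicSet 𝕜 X := by
  rw [mem_superErgodicSet_iff, not_lt]
  exact ⟨fun h => h.ge, fun h => le_antisymm (eta_le_omega_one T) h⟩

end Ergodic

/-! ### The space of operators as a continuous image of the Baire space -/

section OperatorSpace

variable {𝕜 : Type*} [RCLike 𝕜] {X : Type*} [NormedAddCommGroup X] [NormedSpace 𝕜 X]

/-- An operator is determined by its values on a dense sequence `d`. For operators of norm at most
`M` these values run through the closed set of sequences `f` with
`‖∑ cₙ • fₙ‖ ≤ M * ‖∑ cₙ • dₙ‖` for finitely supported `c`, and the operator depends continuously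
on them by equicontinuity. -/
theorem analyticSet_univ_pointwiseConvergenceCLM [CompleteSpace X]
    [TopologicalSpace.SeparableSpace X] : AnalyticSet (univ : Set (X →Lₚₜ[𝕜] X)) := by
  have : SecondCountableTopology X := UniformSpace.secondCountable_of_separable X
  let d : ℕ → X := TopologicalSpace.denseSeq X
  have hd : DenseRange d := TopologicalSpace.denseRange_denseSeq X
  let G : ℕ → Set (ℕ → X) := fun M => {f | ∀ c : ℕ →₀ 𝕜,
    ‖Finsupp.linearCombination 𝕜 f c‖ ≤ M * ‖Finsupp.linearCombination 𝕜 d c‖}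
  have hG : ∀ M, IsClosed (G M) := by
    intro M
    simp only [G, ofPred_forall]
    refine isClosed_iInter fun c => isClosed_le ?_ continuous_const
    simp only [Finsupp.linearCombination_apply, Finsupp.sum]
    fun_prop
  have hD : DenseRange (Finsupp.linearCombination 𝕜 d) := by
    refine hd.mono ?_
    rintro _ ⟨n, rfl⟩
    exact ⟨Finsupp.single n 1, by simp⟩
  let ext : (ℕ → X) → (X →Lₚₜ[𝕜] X) := fun f =>
    toSOT ((Finsupp.linearCombination 𝕜 f).extendOfNorm (Finsupp.linearCombination 𝕜 d))
  have hext : ∀ M, ∀ f ∈ G M, ∀ n, ext f (d n) = f n := by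
    intro M f hf n
    have := LinearMap.extendOfNorm_eq hD ⟨M, hf⟩ (Finsupp.single n 1)
    rw [Finsupp.linearCombination_single, Finsupp.linearCombination_single, one_smul,
      one_smul] at this
    exact this
  have hnorm : ∀ M, ∀ f ∈ G M, ∀ x, ‖ext f x‖ ≤ M * ‖x‖ := fun M f hf x =>
    LinearMap.norm_extendOfNorm_apply_le hD M hf x
  have hcont : ∀ M, ContinuousOn ext (G M) := by
    intro M
    rw [continuousOn_iff_continuous_domRestrict]
    refine PointwiseConvergenceCLM.continuous_of_continuous_eval fun x => ?_
    refine continuous_of_uniform_approx_of_continuous fun u hu => ?_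
    obtain ⟨ε, hε, hεu⟩ := Metric.mem_uniformity_dist.1 hu
    obtain ⟨n, hn⟩ := hd.exists_dist_lt x (show 0 < ε / (M + 1) by positivity)
    refine ⟨fun f => f.1 n, (continuous_apply n).comp continuous_subtype_val, fun f => hεu ?_⟩
    change dist (ext f.1 x) (f.1 n) < ε
    rw [← hext M f.1 f.2 n, dist_eq_norm, ← map_sub]
    rw [dist_eq_norm, lt_div_iff₀ (by positivity)] at hn
    have h1 := hnorm M f.1 f.2 (x - d n)
    have h2 := norm_nonneg (x - d n)
    nlinarith
  have huniv : (univ : Set (X →Lₚₜ[𝕜] X)) = ⋃ M, ext '' G M := by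
    refine (eq_univ_of_forall fun T => ?_).symm
    obtain ⟨M, hM⟩ := exists_nat_ge ‖toSOT.symm T‖
    have hlc : ∀ c, Finsupp.linearCombination 𝕜 (fun n => T (d n)) c =
        T (Finsupp.linearCombination 𝕜 d c) := by
      intro c
      simp [Finsupp.linearCombination_apply, Finsupp.sum, map_sum]
    have hmem : (fun n => T (d n)) ∈ G M := by
      intro c
      rw [hlc]
      exact ((toSOT.symm T).le_opNorm _).trans (by gcongr)
    refine mem_iUnion.2 ⟨M, _, hmem, ?_⟩
    ext x
    refine congrFun (hd.equalizer (ContinuousLinearMap.continuous _)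
      (ContinuousLinearMap.continuous _) (funext fun n => ?_)) x
    exact hext M _ hmem n
  rw [huniv]
  exact AnalyticSet.iUnion fun M => (hG M).analyticSet.image_of_continuousOn (hcont M)

/-- The strong operator topology is not metrizable in general, so `L(X)` is accessed through a
continuous surjection from the Baire space. -/
theorem exists_continuous_surjective_baire [CompleteSpace X] [TopologicalSpace.SeparableSpace X] :
    ∃ f : (ℕ → ℕ) → (X →Lₚₜ[𝕜] X), Continuous f ∧ Function.Surjective f := by
  have hX := analyticSet_univ_pointwiseConvergenceCLM (𝕜 := 𝕜) (X := X)
  rw [AnalyticSet] at hX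
  rcases hX with h | ⟨f, hf, hr⟩
  · exact absurd h univ_nonempty.ne_empty
  · exact ⟨f, hf, range_eq_univ.1 hr⟩

/-- On all of `L(X)` the powers of an operator are not continuous in the strong operator topology,
but they are Borel: evaluation is continuous in the vector and in the operator separately, hence
jointly measurable. -/
theorem measurable_cesaro_apply [TopologicalSpace.SeparableSpace X]
    [MeasurableSpace X] [BorelSpace X] (n : ℕ) (x : X) :
    Measurable[borel (X →Lₚₜ[𝕜] X)] fun T => cesaro (toSOT.symm T) n x := by
  have : SecondCountableTopology X := UniformSpace.secondCountable_of_separable X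
  let _ : MeasurableSpace (X →Lₚₜ[𝕜] X) := borel _
  have : BorelSpace (X →Lₚₜ[𝕜] X) := ⟨rfl⟩
  have heval : Measurable (Function.uncurry fun (x : X) (T : X →Lₚₜ[𝕜] X) => T x) :=
    measurable_uncurry_of_continuous_of_measurable
      (fun T => (toSOT.symm T).continuous) fun x => (continuous_eval_const x).measurable
  have hpow : ∀ k, Measurable fun T : X →Lₚₜ[𝕜] X => (toSOT.symm T ^ k) x := by
    intro k
    induction k with
    | zero => exact measurable_const
    | succ k ih =>
      simp_rw [pow_succ']
      exact heval.comp (ih.prodMk measurable_id)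
  simp_rw [cesaro_apply]
  exact (Finset.measurable_fun_sum _ fun k _ => hpow k).const_smul _

theorem measurableSet_mem_entropyTree [TopologicalSpace.SeparableSpace X] (ε : ℝ) (s : List ℕ) :
    MeasurableSet[borel (X →Lₚₜ[𝕜] X)] {T | s ∈ entropyTree (toSOT.symm T) ε} := by
  have : SecondCountableTopology X := UniformSpace.secondCountable_of_separable X
  let _ : MeasurableSpace (X →Lₚₜ[𝕜] X) := borel _
  let _ : MeasurableSpace X := borel _
  have : BorelSpace X := ⟨rfl⟩
  obtain ⟨D, hDc, hD⟩ := TopologicalSpace.exists_countable_dense (Metric.closedBall (0 : X) 1)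
  -- the strict inequalities are open in the witness, which may thus be taken in a countable set
  have hset : {T : X →Lₚₜ[𝕜] X | s ∈ entropyTree (toSOT.symm T) ε} =
      {T | s.Pairwise (· < ·) ∧ (∀ n ∈ s, 0 < n) ∧ (s.length ≤ 1 ∨ ∃ x ∈ D,
        ∀ (p : ℕ) (hp : p + 1 < s.length),
        ε < ‖cesaro (toSOT.symm T) s[p] x.1 - cesaro (toSOT.symm T) s[p + 1] x.1‖)} := by
    ext T
    refine and_congr_right fun _ => and_congr_right fun _ => or_congr_right ?_
    constructor
    · rintro ⟨x, hx, h⟩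
      have hopen : IsOpen {x : Metric.closedBall (0 : X) 1 | ∀ i : Fin (s.length - 1),
          ε < ‖cesaro (toSOT.symm T) (s[i.1]'(by omega)) x.1 -
            cesaro (toSOT.symm T) (s[i.1 + 1]'(by omega)) x.1‖} := by
        simp only [ofPred_forall]
        refine isOpen_iInter_of_finite fun i => isOpen_lt continuous_const ?_
        fun_prop
      obtain ⟨y, hyD, hy⟩ := hD.exists_mem_open hopen
        ⟨⟨x, by simpa using hx⟩, fun i => h i.1 (by omega)⟩
      exact ⟨y, hyD, fun p hp => hy ⟨p, by omega⟩⟩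
    · rintro ⟨x, -, h⟩
      exact ⟨x.1, mem_closedBall_zero_iff.1 x.2, h⟩
  rw [hset]
  have : Countable D := hDc.to_subtype
  rw [measurableSet_setOfPred]
  refine measurable_const.and (measurable_const.and (measurable_const.or ?_))
  have hex : ∀ T : X →Lₚₜ[𝕜] X, (∃ x ∈ D, ∀ (p : ℕ) (hp : p + 1 < s.length),
        ε < ‖cesaro (toSOT.symm T) s[p] x.1 - cesaro (toSOT.symm T) s[p + 1] x.1‖) ↔
      ∃ x : D, ∀ i : Fin (s.length - 1), ε < ‖cesaro (toSOT.symm T) (s[i.1]'(by omega)) x.1.1 -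
            cesaro (toSOT.symm T) (s[i.1 + 1]'(by omega)) x.1.1‖ := fun T =>
    ⟨fun ⟨x, hx, h⟩ => ⟨⟨x, hx⟩, fun i => h i.1 (by omega)⟩,
      fun ⟨x, h⟩ => ⟨x.1, x.2, fun p hp => h ⟨p, by omega⟩⟩⟩
  simp only [hex]
  refine Measurable.exists fun x => Measurable.forall fun i => measurableSet_setOfPred.1 ?_
  exact measurableSet_lt measurable_const
    ((measurable_cesaro_apply _ _).sub (measurable_cesaro_apply _ _)).norm

end OperatorSpace

/-! ### Borel ranks, analyticity of simulation, and boundedness -/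

section Descriptive

theorem wellFounded_extendsIn {A : Set (List ℕ)} (h : Acc (ExtendsIn A) []) :
    WellFounded (ExtendsIn A) :=
  ⟨fun _ => ⟨_, fun _ hs => h.inv ⟨hs.1, (Nat.zero_le _).trans_lt hs.2.1, List.nil_prefix⟩⟩⟩

/-- By induction on `β`: the rank of `s` is at most `β` if each of the countably many proper
extensions of `s` has rank at most some `γ < β`, and there are countably many such `γ`. -/
theorem measurableSet_rank_le {Ω : Type*} [MeasurableSpace Ω] {A : Ω → Set (List ℕ)}
    (hA : ∀ s, MeasurableSet {w | s ∈ A w}) (β : Ordinal.{0}) (hβ : β < ω₁) (s : List ℕ) :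
    MeasurableSet {w | ∃ h : Acc (ExtendsIn (A w)) s, h.rank ≤ β} := by
  induction β using WellFoundedLT.induction generalizing s with
  | ind β ih =>
    have hiff : ∀ w, (∃ h : Acc (ExtendsIn (A w)) s, h.rank ≤ β) ↔
        ∀ s', ExtendsIn (A w) s' s → ∃ γ : Iio β, ∃ h : Acc (ExtendsIn (A w)) s', h.rank ≤ γ := by
      intro w
      constructor
      · rintro ⟨h, hle⟩ s' hs'
        exact ⟨⟨_, (rank_le_iff h).1 hle s' hs'⟩, h.inv hs', le_rfl⟩
      · intro h
        have hacc : Acc (ExtendsIn (A w)) s := ⟨_, fun s' hs' => (h s' hs').choose_spec.choose⟩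
        refine ⟨hacc, (rank_le_iff hacc).2 fun s' hs' => ?_⟩
        obtain ⟨γ, h', hle⟩ := h s' hs'
        exact hle.trans_lt γ.2
    have : Countable (Iio β) := by
      rw [Cardinal.lt_omega_iff_card_lt, ← Cardinal.succ_aleph0, Order.lt_succ_iff] at hβ
      rw [← Cardinal.mk_le_aleph0_iff, Cardinal.mk_Iio_ordinal, Cardinal.lift_le_aleph0]
      exact hβ
    simp only [hiff]
    rw [measurableSet_setOfPred]
    refine Measurable.forall fun s' => Measurable.imp ?_ (Measurable.exists fun γ =>
      measurableSet_setOfPred.1 (ih γ γ.2 (γ.2.trans hβ) s'))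
    exact (measurableSet_setOfPred.1 (hA s')).and measurable_const

/-- The existence of a simulation between trees depending in a Borel way on a parameter is an
analytic condition on the parameter, as simulations form a Polish space. -/
theorem analyticSet_exists_isSimulation {Y : Type*} [TopologicalSpace Y] [PolishSpace Y]
    [MeasurableSpace Y] [BorelSpace Y] {A B : Y → Set (List ℕ)}
    (hA : ∀ s, MeasurableSet {y | s ∈ A y}) (hB : ∀ s, MeasurableSet {y | s ∈ B y})
    {p : Y → (List ℕ × List ℕ → Bool) → Prop}
    (hp : MeasurableSet {q : Y × (List ℕ × List ℕ → Bool) | p q.1 q.2}) :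
    AnalyticSet {y | ∃ R, IsSimulation (A y) (B y) R ∧ p y R} := by
  have heq : {y | ∃ R, IsSimulation (A y) (B y) R ∧ p y R} =
      Prod.fst '' {q : Y × (List ℕ × List ℕ → Bool) |
        IsSimulation (A q.1) (B q.1) q.2 ∧ p q.1 q.2} := by
    ext y
    simp
  rw [heq]
  have : PolishSpace (List ℕ × List ℕ → Bool) := {}
  refine (MeasurableSet.analyticSet ?_).image_of_continuous continuous_fst
  have hR : ∀ u : List ℕ × List ℕ,
      Measurable fun q : Y × (List ℕ × List ℕ → Bool) => q.2 u = true := by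
    intro u
    have hu : Measurable fun q : Y × (List ℕ × List ℕ → Bool) => q.2 u :=
      (measurable_pi_apply u).comp measurable_snd
    exact measurableSet_setOfPred.1 (hu (MeasurableSet.singleton true))
  have hA' := fun s s' => ((measurableSet_setOfPred.1 (hA s')).comp
    (measurable_fst (β := List ℕ × List ℕ → Bool))).and
      (measurable_const (a := s.length < s'.length ∧ s <+: s'))
  have hB' := fun s s' => ((measurableSet_setOfPred.1 (hB s')).comp
    (measurable_fst (β := List ℕ × List ℕ → Bool))).and
      (measurable_const (a := s.length < s'.length ∧ s <+: s'))
  rw [measurableSet_setOfPred]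
  refine Measurable.and ?_ (measurableSet_setOfPred.1 hp)
  exact Measurable.forall fun s => Measurable.forall fun t => (hR _).imp <|
    Measurable.forall fun s' => (hA' s s').imp <| Measurable.exists fun t' => (hB' t t').and (hR _)

/-- The boundedness principle: if `g` is a continuous family, parametrized by the Baire space, of
(characteristic functions of) well-founded trees, then pairs `(u, s)` with `s` a node of `g a` for
some `a` extending `u` form a well-founded countable relation into which all these trees map. -/
theorem exists_rank_le_of_continuous {g : (ℕ → ℕ) → List ℕ → Bool} (hg : Continuous g)
    (hpre : ∀ a s t, s <+: t → g a t = true → g a s = true)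
    (hacc : ∀ a, Acc (ExtendsIn {s | g a s = true}) []) :
    ∃ β < ω₁, ∀ a, (hacc a).rank ≤ β := by
  let r : List ℕ × List ℕ → List ℕ × List ℕ → Prop := fun p' p => ∃ a,
    p.1 = PiNat.res a p.2.length ∧ p'.1 = PiNat.res a p'.2.length ∧
      ExtendsIn {s | g a s = true} p'.2 p.2
  have hwf : WellFounded r := by
    rw [wellFounded_iff_isEmpty_descending_chain]
    refine ⟨fun ⟨p, hp⟩ => ?_⟩
    choose a ha1 ha2 ha3 using hp
    have hlen : ∀ n, n ≤ (p n).2.length := by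
      intro n
      induction n with
      | zero => exact Nat.zero_le _
      | succ n ih => exact Nat.succ_le_of_lt (ih.trans_lt (ha3 n).2.1)
    have hpp : ∀ j n, j ≤ n → (p j).2 <+: (p n).2 := by
      intro j n h
      induction n, h using Nat.le_induction with
      | base => exact List.prefix_rfl
      | succ n _ ih => exact ih.trans (ha3 n).2.2
    have hstep : ∀ n i, i ≤ n → a (n + 1) i = a n i := by
      intro n i hi
      have h := (ha1 (n + 1)).symm.trans (ha2 n)
      exact PiNat.res_eq_res.1 h (lt_of_le_of_lt hi (hlen (n + 1)))
    have hconst : ∀ i n, i ≤ n → a n i = a i i := by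
      intro i n h
      induction n, h using Nat.le_induction with
      | base => rfl
      | succ n hn ih => exact (hstep n i hn).trans ih
    -- the parameters converge, and membership of a fixed list passes to the limit
    let b : ℕ → ℕ := fun i => a i i
    have hlim : Tendsto a atTop (𝓝 b) := by
      refine tendsto_pi_nhds.2 fun i => tendsto_const_nhds.congr' ?_
      filter_upwards [eventually_ge_atTop i] with n hn
      exact (hconst i n hn).symm
    have hb : ∀ j, g b (p j).2 = true := by
      intro j
      have h1 : Tendsto (fun n => g (a n) (p j).2) atTop (𝓝 (g b (p j).2)) :=
        (((continuous_apply (p j).2).comp hg).tendsto b).comp hlim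
      refine tendsto_nhds_unique h1 (tendsto_const_nhds.congr' ?_)
      filter_upwards [eventually_ge_atTop j] with n hn
      exact (hpre _ _ _ (hpp j (n + 1) (by omega)) (ha3 n).1).symm
    exact (wellFounded_iff_isEmpty_descending_chain.1 (wellFounded_extendsIn (hacc b))).false
      ⟨fun j => (p j).2, fun j => ⟨hb (j + 1), (ha3 j).2⟩⟩
  refine ⟨(hwf.apply ([], [])).rank, rank_lt_omega_one _, fun a => ?_⟩
  refine rank_le_of_simulation (R := fun s p => p = (PiNat.res a s.length, s)) ?_ _ rfl _
  rintro s _ rfl s' hs'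
  exact ⟨_, ⟨a, rfl, rfl, hs'⟩, rfl⟩

theorem rank_nat_le {k : ℕ} (h : Acc (· < ·) k) : h.rank ≤ (k : Ordinal.{0}) := by
  induction k using Nat.strong_induction_on with
  | h k ih =>
    refine (rank_le_iff h).2 fun j hj => (ih j hj _).trans_lt ?_
    exact_mod_cast hj

/-- The lists of the tree are mapped to `ℕ` by the number of entries that may still be added. -/
theorem height_lt_omega0_of_length_le {A : Descriptive.tree ℕ} (hA : [] ∈ A) {K : ℕ}
    (hK : ∀ s ∈ A, s.length ≤ K) : height A < ω := by
  have hR : ∀ (s : List ℕ) (k : ℕ), s.length + k = K → ∀ s', ExtendsIn (A : Set (List ℕ)) s' s →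
      ∃ k', k' < k ∧ s'.length + k' = K := by
    intro s k hk s' hs'
    have h1 := hK s' hs'.1
    have h2 := hs'.2.1
    exact ⟨K - s'.length, by omega, by omega⟩
  have hacc := acc_of_simulation hR (wellFounded_lt.apply K) (a := []) (by simp)
  rw [height_of_acc hA hacc]
  refine Ordinal.isSuccLimit_omega0.succ_lt (lt_of_le_of_lt ?_ (Ordinal.natCast_lt_omega0 K))
  exact (rank_le_of_simulation hR (wellFounded_lt.apply K) (by simp) hacc).trans (rank_nat_le _)

end Descriptive

/-! ### Definability of the index -/

section Indices

variable {𝕜 : Type*} [RCLike 𝕜] {X : Type*} [NormedAddCommGroup X] [NormedSpace 𝕜 X]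

theorem eta_le_omega0_of_isUniformlyErgodic {T : X →Lₚₜ[𝕜] X}
    (hT : T ∈ uniformlyErgodicSet 𝕜 X) : eta T ≤ ω := by
  rw [eta_eq_iSup]
  refine Ordinal.iSup_le fun n => ?_
  obtain ⟨S, hS⟩ := hT
  obtain ⟨N, hN⟩ := Metric.cauchySeq_iff.1 hS.cauchySeq (1 / ((n : ℝ) + 1)) Nat.one_div_pos_of_nat
  refine (height_lt_omega0_of_length_le (nil_mem_scaleTree T n) (K := N + 1) ?_).le
  rintro s ⟨hs, -, hx⟩
  by_contra! hlen
  rcases hx with hx | ⟨x, hx1, hx⟩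
  · omega
  have h1 := le_getElem_of_pairwise_lt hs N (by omega)
  have h2 := le_getElem_of_pairwise_lt hs (N + 1) hlen
  have h3 := hN _ h1 _ ((Nat.le_succ N).trans h2)
  have h4 := hx N hlen
  rw [dist_eq_norm] at h3
  rw [← sub_apply] at h4
  exact (h4.trans_le (ContinuousLinearMap.unit_le_opNorm _ x hx1)).not_gt h3

theorem analyticSet_of_surjective {P Q : Type*} [TopologicalSpace P] [TopologicalSpace Q]
    {f : P → Q} (hf : Continuous f) (hsurj : Function.Surjective f) {C : Set Q}
    (hC : AnalyticSet (f ⁻¹' C)) : AnalyticSet C := by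
  rw [← image_preimage_eq C hsurj]
  exact hC.image_of_continuous hf

variable [TopologicalSpace.SeparableSpace X]

theorem measurableSet_mem_scaleTree {Y : Type*} [TopologicalSpace Y] [MeasurableSpace Y]
    [BorelSpace Y] {f : Y → (X →Lₚₜ[𝕜] X)} (hf : Continuous f) (n : ℕ) (s : List ℕ) :
    MeasurableSet {y | s ∈ (scaleTree (f y) n : Set (List ℕ))} :=
  BorelSpace.measurable_eq (α := Y) ▸ hf.borel_measurable (measurableSet_mem_entropyTree _ s)

variable [CompleteSpace X]

theorem analyticSet_eta_le :
    AnalyticSet {p : (X →Lₚₜ[𝕜] X) × (X →Lₚₜ[𝕜] X) | eta p.2 ≤ eta p.1} := by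
  obtain ⟨f, hf, hsurj⟩ := exists_continuous_surjective_baire (𝕜 := 𝕜) (X := X)
  refine analyticSet_of_surjective (hf.prodMap hf) (hsurj.prodMap hsurj) ?_
  have heq : Prod.map f f ⁻¹' {p : (X →Lₚₜ[𝕜] X) × (X →Lₚₜ[𝕜] X) | eta p.2 ≤ eta p.1} =
      ⋂ n, ⋃ m, {q : (ℕ → ℕ) × (ℕ → ℕ) | ∃ R,
        IsSimulation (scaleTree (f q.2) n) (scaleTree (f q.1) m) R ∧ R ([], []) = true} := by
    ext q
    simp [eta_le_eta_iff, height_le_height_iff, nil_mem_scaleTree]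
  rw [heq]
  refine AnalyticSet.iInter fun n => AnalyticSet.iUnion fun m =>
    analyticSet_exists_isSimulation (measurableSet_mem_scaleTree (hf.comp continuous_snd) n)
      (measurableSet_mem_scaleTree (hf.comp continuous_fst) m)
      (p := fun _ R => R ([], []) = true) ?_
  have hu : Measurable fun q : ((ℕ → ℕ) × (ℕ → ℕ)) × (List ℕ × List ℕ → Bool) => q.2 ([], []) :=
    (measurable_pi_apply _).comp measurable_snd
  exact hu (MeasurableSet.singleton true)

theorem analyticSet_eta_lt :
    AnalyticSet {p : (X →Lₚₜ[𝕜] X) × (X →Lₚₜ[𝕜] X) | eta p.2 < eta p.1 ∨ eta p.1 = ω₁} := by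
  obtain ⟨f, hf, hsurj⟩ := exists_continuous_surjective_baire (𝕜 := 𝕜) (X := X)
  refine analyticSet_of_surjective (hf.prodMap hf) (hsurj.prodMap hsurj) ?_
  have heq : Prod.map f f ⁻¹'
      {p : (X →Lₚₜ[𝕜] X) × (X →Lₚₜ[𝕜] X) | eta p.2 < eta p.1 ∨ eta p.1 = ω₁} =
      ⋃ m, ⋂ n, {q : (ℕ → ℕ) × (ℕ → ℕ) | ∃ R,
        IsSimulation (scaleTree (f q.2) n) (scaleTree (f q.1) m) R ∧
          ∃ t, ExtendsIn (scaleTree (f q.1) m : Set (List ℕ)) t [] ∧ R ([], t) = true} := by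
    ext q
    simp [eta_lt_eta_iff, height_lt_height_iff, nil_mem_scaleTree]
  rw [heq]
  refine AnalyticSet.iUnion fun m => AnalyticSet.iInter fun n =>
    analyticSet_exists_isSimulation (measurableSet_mem_scaleTree (hf.comp continuous_snd) n)
      (measurableSet_mem_scaleTree (hf.comp continuous_fst) m)
      (p := fun q R => ∃ t, ExtendsIn (scaleTree (f q.1) m : Set (List ℕ)) t [] ∧
        R ([], t) = true) ?_
  rw [measurableSet_setOfPred]
  refine Measurable.exists fun t => Measurable.and (Measurable.and ?_ measurable_const) ?_
  · exact (measurableSet_setOfPred.1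
      (measurableSet_mem_scaleTree (hf.comp continuous_fst) m t)).comp measurable_fst
  · have hu : Measurable fun q : ((ℕ → ℕ) × (ℕ → ℕ)) × (List ℕ × List ℕ → Bool) => q.2 ([], t) :=
      (measurable_pi_apply _).comp measurable_snd
    exact measurableSet_setOfPred.1 (hu (MeasurableSet.singleton true))

theorem isCoanalytic_superErgodicSet : IsCoanalytic (superErgodicSet 𝕜 X) := by
  obtain ⟨f, hf, hsurj⟩ := exists_continuous_surjective_baire (𝕜 := 𝕜) (X := X)
  refine analyticSet_of_surjective hf hsurj ?_
  -- on the diagonal only the alternative `eta T = ω₁` is possible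
  have heq : f ⁻¹' (superErgodicSet 𝕜 X)ᶜ = (fun a => (f a, f a)) ⁻¹'
      {p : (X →Lₚₜ[𝕜] X) × (X →Lₚₜ[𝕜] X) | eta p.2 < eta p.1 ∨ eta p.1 = ω₁} := by
    ext a
    simp [← eta_eq_omega_one_iff]
  rw [heq]
  exact analyticSet_eta_lt.preimage (by fun_prop)

/-- As `eta` equals `ω₁` off the set, the complements of the two relations are given by plain
comparisons of indices, which are analytic. -/
theorem isCoanalyticRank_eta :
    IsCoanalyticRank (superErgodicSet 𝕜 X) (eta (𝕜 := 𝕜) (X := X)) where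
  coanalytic := isCoanalytic_superErgodicSet
  lt_omega_one T hT := (mem_superErgodicSet_iff T).1 hT
  coanalytic_le := by
    rw [IsCoanalytic]
    convert analyticSet_eta_lt (𝕜 := 𝕜) (X := X) using 1
    ext ⟨S, T⟩
    have hS := eta_eq_omega_one_iff S
    have hT := eta_eq_omega_one_iff T
    have hS' := eta_le_omega_one S
    have hlt : eta T < eta S → T ∈ superErgodicSet 𝕜 X := fun h =>
      (mem_superErgodicSet_iff T).2 (h.trans_le hS')
    simp only [mem_compl_iff, mem_ofPred_eq, not_and, Classical.not_imp, not_le, hS]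
    tauto
  coanalytic_lt := by
    rw [IsCoanalytic]
    convert analyticSet_eta_le (𝕜 := 𝕜) (X := X) using 1
    ext ⟨S, T⟩
    have hS : S ∉ superErgodicSet 𝕜 X → eta T ≤ eta S := fun h =>
      ((eta_eq_omega_one_iff S).2 h).symm ▸ eta_le_omega_one T
    have hT : S ∈ superErgodicSet 𝕜 X → eta T ≤ eta S → T ∈ superErgodicSet 𝕜 X := fun h h' =>
      (mem_superErgodicSet_iff T).2 (h'.trans_lt ((mem_superErgodicSet_iff S).1 h))
    simp only [mem_compl_iff, mem_ofPred_eq, not_and, Classical.not_imp, not_lt]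
    tauto

theorem measurableSet_superErgodicSet_of_iSup_lt
    (h : (⨆ T : superErgodicSet 𝕜 X, eta (T : X →Lₚₜ[𝕜] X)) < ω₁) :
    MeasurableSet[borel (X →Lₚₜ[𝕜] X)] (superErgodicSet 𝕜 X) := by
  let _ : MeasurableSpace (X →Lₚₜ[𝕜] X) := borel _
  have : BorelSpace (X →Lₚₜ[𝕜] X) := ⟨rfl⟩
  have hbdd : BddAbove (range fun T : superErgodicSet 𝕜 X => eta (T : X →Lₚₜ[𝕜] X)) := by
    refine ⟨ω₁, ?_⟩
    rintro _ ⟨T, rfl⟩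
    exact eta_le_omega_one _
  have heq : superErgodicSet 𝕜 X = ⋂ n,
      {T | ∃ h : Acc (ExtendsIn (scaleTree T n : Set (List ℕ))) [],
      h.rank ≤ ⨆ T : superErgodicSet 𝕜 X, eta (T : X →Lₚₜ[𝕜] X)} := by
    ext T
    rw [mem_iInter]
    constructor
    · intro hT n
      have hacc := (height_lt_omega_one_iff (nil_mem_scaleTree T n)).1
        ((eta_lt_omega_one_iff T).1 ((mem_superErgodicSet_iff T).1 hT) n)
      refine ⟨hacc, (Order.le_succ _).trans ?_⟩
      rw [← height_of_acc (nil_mem_scaleTree T n) hacc]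
      exact (height_le_eta T n).trans (le_ciSup hbdd ⟨T, hT⟩)
    · intro hT
      rw [mem_superErgodicSet_iff, eta_lt_omega_one_iff]
      exact fun n => (height_lt_omega_one_iff (nil_mem_scaleTree T n)).2 (hT n).choose
  rw [heq]
  exact MeasurableSet.iInter fun n =>
    measurableSet_rank_le (measurableSet_mem_scaleTree continuous_id n) _ h []

/-- If the set of super-ergodic operators is Borel, its trees at a fixed scale form an analytic set
of well-founded trees, whose heights are bounded by `exists_rank_le_of_continuous`. -/
theorem iSup_eta_lt_of_measurableSet
    (h : MeasurableSet[borel (X →Lₚₜ[𝕜] X)] (superErgodicSet 𝕜 X)) :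
    (⨆ T : superErgodicSet 𝕜 X, eta (T : X →Lₚₜ[𝕜] X)) < ω₁ := by
  classical
  obtain ⟨f, hf, hsurj⟩ := exists_continuous_surjective_baire (𝕜 := 𝕜) (X := X)
  have hmeas : MeasurableSet (f ⁻¹' superErgodicSet 𝕜 X) :=
    BorelSpace.measurable_eq (α := ℕ → ℕ) ▸ hf.borel_measurable h
  -- for each scale, the characteristic functions of the trees of super-ergodic operators form an
  -- analytic set of well-founded trees
  have hbound : ∀ n, ∃ β < ω₁, ∀ T ∈ superErgodicSet 𝕜 X, height (scaleTree T n) ≤ β := by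
    intro n
    let Φ : (ℕ → ℕ) → List ℕ → Bool := fun a s => decide (s ∈ scaleTree (f a) n)
    have hΦ : Measurable Φ := by
      refine measurable_pi_iff.2 fun s => measurable_to_bool ?_
      convert measurableSet_mem_scaleTree hf n s using 1
      ext a
      simp [Φ]
    have han := hmeas.analyticSet_image hΦ
    rw [AnalyticSet] at han
    rcases han with hempty | ⟨g, hg, hrange⟩
    · refine ⟨0, Ordinal.omega_pos 1, fun T hT => ?_⟩
      obtain ⟨a, rfl⟩ := hsurj T
      exact absurd (mem_image_of_mem Φ hT) (hempty ▸ notMem_empty _)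
    have hg' : ∀ b, ∃ T ∈ superErgodicSet 𝕜 X,
        {s | g b s = true} = (scaleTree T n : Set (List ℕ)) := by
      intro b
      obtain ⟨a, ha, hab⟩ := hrange ▸ mem_range_self b
      refine ⟨f a, ha, ?_⟩
      rw [← hab]
      ext s
      simp [Φ]
    have hacc : ∀ T ∈ superErgodicSet 𝕜 X, Acc (ExtendsIn (scaleTree T n : Set (List ℕ))) [] :=
      fun T hT => (height_lt_omega_one_iff (nil_mem_scaleTree T n)).1
        ((eta_lt_omega_one_iff T).1 ((mem_superErgodicSet_iff T).1 hT) n)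
    have hgacc : ∀ b, Acc (ExtendsIn {s | g b s = true}) [] := by
      intro b
      obtain ⟨T, hT, hb⟩ := hg' b
      exact hb ▸ hacc T hT
    obtain ⟨β, hβ, hle⟩ := exists_rank_le_of_continuous hg (fun b s t hst ht => by
      obtain ⟨T, -, hb⟩ := hg' b
      have ht' : t ∈ (scaleTree T n : Set (List ℕ)) := hb ▸ ht
      have hs' : s ∈ (scaleTree T n : Set (List ℕ)) := Descriptive.Tree.mem_of_prefix hst ht'
      exact hb.symm.subset hs') hgacc
    refine ⟨Order.succ β, (Cardinal.isSuccLimit_omega 1).succ_lt hβ, fun T hT => ?_⟩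
    obtain ⟨a, rfl⟩ := hsurj T
    obtain ⟨b, hb⟩ := hrange.symm ▸ mem_image_of_mem Φ hT
    rw [height_of_acc (nil_mem_scaleTree _ n) (hacc _ hT)]
    refine Order.succ_le_succ (le_trans ?_ (hle b))
    have hset : (scaleTree (f a) n : Set (List ℕ)) = {s | g b s = true} := by
      rw [hb]
      ext s
      simp [Φ]
    refine rank_le_of_simulation (R := Eq) ?_ (hgacc b) rfl _
    rintro s _ rfl s' hs'
    exact ⟨s', hset ▸ hs', rfl⟩
  choose β hβ hle using hbound
  refine lt_of_le_of_lt (ciSup_le' fun T => ?_) (Ordinal.iSup_lt_omega_one hβ)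
  rw [eta_eq_iSup]
  exact Ordinal.iSup_le fun n => (hle n T T.2).trans (Ordinal.le_iSup β n)

end Indices

end SuperErgodic

open SuperErgodic in
theorem mainTheorem1 {𝕜 : Type*} [RCLike 𝕜] {X : Type*} [NormedAddCommGroup X] [NormedSpace 𝕜 X]
    [CompleteSpace X] [TopologicalSpace.SeparableSpace X] :
    (∀ T : X →Lₚₜ[𝕜] X, (T ∈ superErgodicSet 𝕜 X ↔ eta T < ω₁) ∧
      (T ∉ superErgodicSet 𝕜 X → eta T = ω₁)) ∧
    IsCoanalytic (superErgodicSet 𝕜 X) ∧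
    IsCoanalyticRank (superErgodicSet 𝕜 X) (eta (𝕜 := 𝕜) (X := X)) ∧
    (∃ α : Ordinal.{0}, α < ω₁ ∧
      uniformlyErgodicSet 𝕜 X ⊆ {T | T ∈ superErgodicSet 𝕜 X ∧ eta T ≤ α}) ∧
    (MeasurableSet[borel (X →Lₚₜ[𝕜] X)] (superErgodicSet 𝕜 X) ↔
      (⨆ T : superErgodicSet 𝕜 X, eta (T : X →Lₚₜ[𝕜] X)) < ω₁) := by
  refine ⟨fun T => ⟨mem_superErgodicSet_iff T, (eta_eq_omega_one_iff T).2⟩,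
    isCoanalytic_superErgodicSet, isCoanalyticRank_eta, ⟨ω, Ordinal.omega0_lt_omega_one, fun T hT => ?_⟩,
    iSup_eta_lt_of_measurableSet, measurableSet_superErgodicSet_of_iSup_lt⟩
  have hle := eta_le_omega0_of_isUniformlyErgodic hT
  exact ⟨(mem_superErgodicSet_iff T).2 (hle.trans_lt Ordinal.omega0_lt_omega_one), hle⟩
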